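/- Let $K$ be a field, $\overline{K}$ an algebraic closure of $K$, and $\sqrt{-1}\in\overline{K}$ a square root of $-1$. An element $\lambda\in\overline{K}$ is called $K$-regular if its degree over $K$ is not a multiple of $\operatorname{char}K$, and $\mathcal R_K$ denotes the set of $K$-regular elements (so $\mathcal R_K=\overline{K}$ if $\operatorname{char}K=0$). For $\lambda\in\mathcal R_K$ with minimal polynomial $X^d+a_{d-1}X^{d-1}+\dots+a_0$ over $K$, put $H_K(\lambda)=-a_{d-1}/d\in K$, and let $\operatorname{Ker}(H_K)=\{\lambda\in\mathcal R_K : H_K(\lambda)=0\}$. Every $\lambda\in\mathcal R_K$ is in a unique way a sum $\lambda=\alpha+\beta$ with $\alpha\in K$ and $\beta\in\operatorname{Ker}(H_K)$, namely with $\alpha=H_K(\lambda)$ and $\beta=\lambda-H_K(\lambda)$; the $K$-involution is the map $\mathcal R_K\to\mathcal R_K$, $\alpha+\beta\mapsto\alpha-\beta$. The splitting bound over $K$ of a square matrix $M$ over $K$ is the maximum degree of the irreducible factors in $K[X]$ of its minimal polynomial. The field $K$ is real closed if it can be made into an ordered field in which every positive element has a square root and over which every polynomial of odd degree has a root. The following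 are equivalent: (a) $K$ is real closed; (b) $K$ is not algebraically closed, $\operatorname{char}K\neq 2$, and every irreducible polynomial in $K[X]$ has degree at most $2$; (c) $K$ is perfect, $\operatorname{char}K\neq 2$, and the group $\operatorname{Aut}(\overline{K}/K)$ has order $2$; (d) $\mathcal R_K=\overline{K}$, and the $K$-involution of $\overline{K}$ is an element of $\operatorname{Aut}(\overline{K}/K)$ different from the identity; (e) $\mathcal R_K=\overline{K}$, and $\operatorname{Ker}(H_K)$ is the $K$-vector subspace of $\overline{K}$ generated by $\sqrt{-1}$; (f) $K$ is not algebraically closed, $\operatorname{char}K\neq 2$, and for every $n$ every matrix $M\in M_n(K)$ has splitting bound at most $2$ over $K$. -/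

import Mathlib

open Polynomial

/-- A field is real closed in the sense of Mathlib (`IsRealClosed`) if and only if it can be made
into an ordered field whose positive elements are squares and over which every polynomial of odd
degree has a root. -/
theorem isRealClosed_iff_exists_linearOrder (K : Type*) [Field K] :
    IsRealClosed K ↔
      ∃ (_ : LinearOrder K) (_ : IsStrictOrderedRing K),
        (∀ x : K, 0 < x → ∃ y : K, y ^ 2 = x) ∧
        (∀ f : K[X], Odd f.natDegree → ∃ x : K, f.IsRoot x) := by
  constructor
  · intro h
    have hss : ∀ x y : K, IsSquare x → IsSquare y → IsSquare (x + y) := by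
      rintro x y ⟨a, rfl⟩ ⟨b, rfl⟩
      rcases IsRealClosed.isSquare_or_isSquare_neg (a * a + b * b) with h1 | ⟨c, hc⟩
      · exact h1
      · by_cases ha : a = 0
        · subst ha
          exact ⟨b, by ring⟩
        · exfalso
          refine IsSemireal.one_add_ne_zero (R := K) (s := (b / a) * (b / a) + (c / a) * (c / a))
            (IsSumSq.add (IsSumSq.mul_self _) (IsSumSq.mul_self _)) ?_
          field_simp
          linear_combination -hc
    have hanti : ∀ x : K, IsSquare x → IsSquare (-x) → x = 0 := by
      rintro x ⟨a, rfl⟩ ⟨b, hb⟩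
      by_contra hx
      have ha : a ≠ 0 := by
        rintro rfl
        exact hx (by ring)
      refine IsSemireal.one_add_ne_zero (R := K) (s := (b / a) * (b / a)) (IsSumSq.mul_self _) ?_
      field_simp
      linear_combination -hb
    let ord : LinearOrder K :=
      { le := fun a b => IsSquare (b - a)
        le_refl := fun a => ⟨0, by ring⟩
        le_trans := fun a b c hab hbc => by
          have := hss _ _ hab hbc
          rwa [show b - a + (c - b) = c - a by ring] at this
        le_antisymm := fun a b hab hba => by
          have := hanti (b - a) hab (by rwa [neg_sub])
          exact (sub_eq_zero.mp this).symm
        le_total := fun a b => by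
          rcases IsRealClosed.isSquare_or_isSquare_neg (b - a) with h1 | h1
          · exact Or.inl h1
          · exact Or.inr (by rwa [neg_sub] at h1)
        toDecidableLE := Classical.decRel _ }
    have hle : ∀ a b : K, a ≤ b ↔ IsSquare (b - a) := fun a b => Iff.rfl
    have hadd : IsOrderedAddMonoid K :=
      { add_le_add_left := fun a b hab c => by
          rw [hle] at hab ⊢
          rwa [show b + c - (a + c) = b - a by ring] }
    have h01 : ZeroLEOneClass K := ⟨by rw [hle]; exact ⟨1, by ring⟩⟩
    refine ⟨ord, IsStrictOrderedRing.of_mul_pos ?_, ?_, ?_⟩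
    · intro a b ha hb
      refine lt_of_le_of_ne ?_ (mul_ne_zero ha.ne' hb.ne').symm
      have h1 := (hle _ _).1 ha.le
      have h2 := (hle _ _).1 hb.le
      rw [hle]
      rw [sub_zero] at *
      exact h1.mul h2
    · intro x hx
      have h1 := (hle _ _).1 hx.le
      rw [sub_zero] at h1
      obtain ⟨y, hy⟩ := h1
      exact ⟨y, by rw [hy]; ring⟩
    · intro f hf
      exact IsRealClosed.exists_isRoot_of_odd_natDegree hf
  · rintro ⟨_, _, hsq, hodd⟩
    refine IsRealClosed.of_linearOrderedField ?_ (fun {f} hf => hodd f hf)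
    intro x hx
    rcases hx.eq_or_lt with rfl | hx
    · exact ⟨0, by ring⟩
    · obtain ⟨y, rfl⟩ := hsq x hx
      exact ⟨y, by ring⟩

namespace FieldProjection

variable (K : Type*) [Field K] (L : Type*) [Field L] [Algebra K L]

/-- The set `R_K` of the `K`-regular elements of `L` (an algebraic closure of `K`): the degree over
`K` is not a multiple of the characteristic of `K`. In characteristic `0` the only multiple of the
characteristic is `0`, so every algebraic element is regular. -/
def regularSet : Set L :=
  {x | ¬ ringChar K ∣ (minpoly K x).natDegree}

variable {L}

/-- The `K`-projection `H_K : R_K → K`: if `X ^ d + a_{d-1} X ^ (d-1) + ⋯ + a_0` is the minimal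
polynomial of `x` over `K`, then `H_K x = - a_{d-1} / d`. -/
noncomputable def proj (x : regularSet K L) : K :=
  -(minpoly K (x : L)).coeff ((minpoly K (x : L)).natDegree - 1) /
    ((minpoly K (x : L)).natDegree : K)

variable (L) in
/-- `Ker (H_K)`, the set of regular elements with `K`-projection `0`. -/
def projKer : Set L :=
  {x | ∃ hx : x ∈ regularSet K L, proj K ⟨x, hx⟩ = 0}

/-- The `K`-vertical component `V_K x = x - H_K x` of a regular element. -/
noncomputable def vert (x : regularSet K L) : L :=
  (x : L) - algebraMap K L (proj K x)

theorem regularSet_isIntegral {x : L} (hx : x ∈ regularSet K L) : IsIntegral K x := by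
  by_contra h
  exact hx (by rw [minpoly.eq_zero h]; simp)

theorem natDegree_cast_ne_zero {x : L} (hx : x ∈ regularSet K L) :
    ((minpoly K x).natDegree : K) ≠ 0 := by
  intro h
  exact hx ((ringChar.spec K _).1 h)

theorem natDegree_minpoly_add_algebraMap (x : L) (a : K) :
    (minpoly K (x + algebraMap K L a)).natDegree = (minpoly K x).natDegree := by
  rw [minpoly.add_algebraMap, natDegree_comp]
  simp

theorem natDegree_minpoly_neg (x : L) :
    (minpoly K (-x)).natDegree = (minpoly K x).natDegree := by
  rw [minpoly.neg, show ((-1 : K[X]) ^ (minpoly K x).natDegree) =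
    C ((-1) ^ (minpoly K x).natDegree) by simp, natDegree_C_mul (by simp), natDegree_comp]
  simp

theorem add_algebraMap_mem {x : L} (hx : x ∈ regularSet K L) (a : K) :
    x + algebraMap K L a ∈ regularSet K L := by
  change ¬ _ ∣ _
  rw [natDegree_minpoly_add_algebraMap]
  exact hx

theorem neg_mem {x : L} (hx : x ∈ regularSet K L) : -x ∈ regularSet K L := by
  change ¬ _ ∣ _
  rw [natDegree_minpoly_neg]
  exact hx

theorem coeff_comp_X_add_C {p : K[X]} (hp : p.Monic) (hd : 0 < p.natDegree) (c : K) :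
    (p.comp (X + C c)).coeff (p.natDegree - 1) =
      p.coeff (p.natDegree - 1) + p.natDegree * c := by
  rw [← taylor_apply, taylor_coeff]
  have h1 : (hasseDeriv (p.natDegree - 1) p).natDegree ≤ 1 :=
    (natDegree_hasseDeriv_le p _).trans (by omega)
  obtain ⟨d, hd'⟩ : ∃ d, p.natDegree = d + 1 := ⟨p.natDegree - 1, by omega⟩
  have h2 : p.coeff (d + 1) = 1 := by rw [← hd']; exact hp
  rw [eq_X_add_C_of_natDegree_le_one h1]
  simp [hasseDeriv_coeff, hd', add_comm, h2]

theorem proj_add_algebraMap (x : regularSet K L) (a : K) :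
    proj K ⟨x + algebraMap K L a, add_algebraMap_mem K x.2 a⟩ = proj K x + a := by
  have hi := regularSet_isIntegral K x.2
  have hd := natDegree_cast_ne_zero K x.2
  unfold proj
  simp only [natDegree_minpoly_add_algebraMap]
  rw [minpoly.add_algebraMap, show (X - C a : K[X]) = X + C (-a) by simp [sub_eq_add_neg],
    coeff_comp_X_add_C K (minpoly.monic hi) (minpoly.natDegree_pos hi)]
  field_simp
  ring

/-- Every regular `x` is, in a unique way, the sum of an element `a` of `K` and of an element `b`
of `Ker (H_K)`, namely `a = H_K x` and `b = V_K x`. -/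
theorem decomposition_iff (x : regularSet K L) (a : K) (b : L) :
    ((x : L) = algebraMap K L a + b ∧ b ∈ projKer K L) ↔ (a = proj K x ∧ b = vert K x) := by
  constructor
  · rintro ⟨hx, hb, hb0⟩
    have h := proj_add_algebraMap K ⟨b, hb⟩ a
    have hxe : (⟨b + algebraMap K L a, add_algebraMap_mem K hb a⟩ : regularSet K L) = x :=
      Subtype.ext (by simp only [hx, add_comm])
    rw [hb0, zero_add] at h
    change proj K ⟨b + algebraMap K L a, add_algebraMap_mem K hb a⟩ = a at h
    rw [hxe] at h
    refine ⟨h.symm, ?_⟩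
    rw [vert, h, hx]
    ring
  · rintro ⟨rfl, rfl⟩
    have hv : vert K x = (x : L) + algebraMap K L (-proj K x) := by
      rw [vert, map_neg, sub_eq_add_neg]
    refine ⟨by rw [vert]; ring, ?_⟩
    rw [hv]
    exact ⟨add_algebraMap_mem K x.2 _, by rw [proj_add_algebraMap]; ring⟩

/-- The `K`-involution on `R_K`: if `x = a + b` with `a ∈ K` and `b ∈ Ker (H_K)`, that is
`a = H_K x` and `b = V_K x`, then `x` is mapped to `a - b`. -/
noncomputable def involution (x : regularSet K L) : regularSet K L :=
  ⟨algebraMap K L (proj K x) - vert K x, by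
    have h : algebraMap K L (proj K x) - vert K x =
        -(x : L) + algebraMap K L (2 * proj K x) := by
      rw [vert, map_mul, map_ofNat]; ring
    rw [h]
    exact add_algebraMap_mem K (neg_mem K x.2) _⟩

end FieldProjection

/-- The splitting bound over `L` of a polynomial `f` over `K`: the maximum degree of the
irreducible factors of `f` in `L[X]` (it is `⊤` for `f = 0`, and `0` if there are no such
factors). -/
noncomputable def Polynomial.splittingBound {K : Type*} [Field K] (L : Type*) [Field L]
    [Algebra K L] (f : K[X]) : ℕ∞ :=
  ⨆ (g : L[X]) (_ : Irreducible g) (_ : g ∣ f.map (algebraMap K L)), (g.natDegree : ℕ∞)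

/-- The splitting bound over `L` of a square matrix over `K`: that of its minimal polynomial. -/
noncomputable def Matrix.splittingBound {K : Type*} [Field K] (L : Type*) [Field L]
    [Algebra K L] {n : ℕ} (M : Matrix (Fin n) (Fin n) K) : ℕ∞ :=
  (minpoly K M).splittingBound L

/-! The bridge between the algebraic conditions and real closedness is a conjugation: a nontrivial
`K`-involution `σ` of the closure with fixed field `K`.

From (a) to (b) is the algebraic proof of the fundamental theorem of algebra: odd polynomials having
roots, Galois degrees are powers of two, and every element of `K(i)` is a square, so nothing lies
above `K(i)`. Under (b) the closure is a quadratic Galois extension, which gives (c), and its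
nontrivial automorphism is a conjugation. Conversely, a conjugation makes `K` real closed: `x + σ x`
and `x * σ x` lie in `K`, which bounds degrees by two, and `σ i = -i` turns sums of two squares into
norms, which are again squares.

Since `x + σ x = 2 H_K x`, the `K`-involution is `σ`, and `Ker (H_K)` is its `-1`-eigenspace, the
line through `i`. Condition (f) restates (b), because every irreducible polynomial is, up to a
constant, the minimal polynomial of a matrix. -/

open IntermediateField Module

/-! ### Irreducible polynomials, Galois degrees and the field `K(i)`. -/

/-- An irreducible polynomial is, up to a nonzero constant, the minimal polynomial of any of its
roots. -/
theorem Irreducible.natDegree_minpoly_eq {K L : Type*} [Field K] [Field L] [Algebra K L]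
    {f : K[X]} (hf : Irreducible f) {x : L} (hx : aeval x f = 0) :
    (minpoly K x).natDegree = f.natDegree := by
  rw [← minpoly.eq_of_irreducible hf hx]
  exact natDegree_mul_C (inv_ne_zero (leadingCoeff_ne_zero.2 hf.ne_zero))

theorem Polynomial.exists_aeval_eq_zero_of_splits {K L : Type*} [Field K] [Field L] [Algebra K L]
    {f : K[X]} (hs : (f.map (algebraMap K L)).Splits) (hd : f.natDegree ≠ 0) :
    ∃ x : L, aeval x f = 0 := by
  obtain ⟨x, hx⟩ := hs.exists_eval_eq_zero (by
    rw [degree_map]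
    exact fun h => hd (natDegree_eq_of_degree_eq_some h))
  exact ⟨x, by rwa [eval_map_algebraMap] at hx⟩

/-- If every polynomial of odd degree over `K` has a root, then the degree of a finite Galois
extension of `K` is a power of two. -/
theorem IsGalois.exists_finrank_eq_two_pow {K : Type*} [Field K]
    (hodd : ∀ f : K[X], Odd f.natDegree → ∃ x, f.IsRoot x)
    (E : Type*) [Field E] [Algebra K E] [FiniteDimensional K E] [IsGalois K E] :
    ∃ n, finrank K E = 2 ^ n := by
  obtain ⟨P⟩ : Nonempty (Sylow 2 Gal(E/K)) := inferInstance
  set F := fixedField (P : Subgroup Gal(E/K)) with hF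
  have hindex : finrank K F = (P : Subgroup Gal(E/K)).index := by
    -- The fixed field of a Sylow 2-subgroup has odd degree, so a primitive element has a minimal
    -- polynomial with a root, and `F` is `K`.
    have h1 := finrank_mul_finrank K F E
    rw [hF, finrank_fixedField_eq_card, ← IsGalois.card_aut_eq_finrank K E,
      ← Subgroup.index_mul_card (P : Subgroup Gal(E/K))] at h1
    exact Nat.eq_of_mul_eq_mul_right Nat.card_pos h1
  have hoddF : Odd (finrank K F) := by
    rw [hindex, ← Nat.not_even_iff_odd, even_iff_two_dvd]
    exact P.not_dvd_index
  obtain ⟨z, hz⟩ := Field.exists_primitive_element K F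
  rw [Field.primitive_element_iff_minpoly_natDegree_eq] at hz
  have hzi : IsIntegral K z := Algebra.IsIntegral.isIntegral z
  obtain ⟨x, hx⟩ := hodd (minpoly K z) (by rwa [hz])
  have h1 := degree_eq_one_of_irreducible_of_root (minpoly.irreducible hzi) hx
  rw [natDegree_eq_of_degree_eq_some (n := 1) h1] at hz
  have h2 := finrank_mul_finrank K F E
  rw [← hz, one_mul, hF, finrank_fixedField_eq_card] at h2
  obtain ⟨n, hn⟩ := IsPGroup.iff_card.1 P.isPGroup'
  exact ⟨n, by rw [← h2]; exact hn⟩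

/-- A field of characteristic not two all of whose elements are squares has no nontrivial finite
Galois extension of `2`-power degree. -/
theorem IsGalois.finrank_eq_one_of_forall_isSquare {F : Type*} [Field F] [NeZero (2 : F)]
    (hsq : ∀ x : F, IsSquare x) (E : Type*) [Field E] [Algebra F E] [FiniteDimensional F E]
    [IsGalois F E] {n : ℕ} (hn : finrank F E = 2 ^ n) : finrank F E = 1 := by
  rcases n with _ | n
  · simpa using hn
  exfalso
  -- A subgroup of index two would give a quadratic extension, but every quadratic polynomial over
  -- `F` has a root because its discriminant is a square.
  obtain ⟨H, hH⟩ := Sylow.exists_subgroup_card_pow_prime (G := Gal(E/F)) 2 (n := n) (by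
    rw [IsGalois.card_aut_eq_finrank, hn]
    exact pow_dvd_pow 2 n.le_succ)
  have hQ : finrank F (fixedField H) = 2 := by
    have h1 := finrank_mul_finrank F (fixedField H) E
    rw [finrank_fixedField_eq_card, hH, hn, pow_succ, mul_comm] at h1
    exact Nat.eq_of_mul_eq_mul_left (by positivity) h1
  obtain ⟨z, hz⟩ := Field.exists_primitive_element F (fixedField H)
  rw [Field.primitive_element_iff_minpoly_natDegree_eq, hQ] at hz
  have hzi : IsIntegral F z := Algebra.IsIntegral.isIntegral z
  obtain ⟨x, hx⟩ := exists_quadratic_eq_zero (a := (1 : F)) (b := (minpoly F z).coeff 1)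
    (c := (minpoly F z).coeff 0) one_ne_zero (hsq _)
  have hroot : (minpoly F z).IsRoot x := by
    have hlead : (minpoly F z).coeff 2 = 1 := by
      rw [← hz]
      exact minpoly.monic hzi
    rw [IsRoot, eval_eq_sum_range, hz, Finset.sum_range_succ, Finset.sum_range_succ,
      Finset.sum_range_one, hlead]
    linear_combination hx
  have h1 := degree_eq_one_of_irreducible_of_root (minpoly.irreducible hzi) hroot
  rw [natDegree_eq_of_degree_eq_some (n := 1) h1] at hz
  omega

/-- The elements of `K(i)`, where `i ^ 2 = -1`, are those of the form `a + b * i`. -/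
theorem IntermediateField.exists_eq_add_mul_of_mem_adjoin {K L : Type*} [Field K] [Field L]
    [Algebra K L] {i : L} (hi : i ^ 2 = -1) {x : L} (hx : x ∈ K⟮i⟯) :
    ∃ a b : K, x = algebraMap K L a + algebraMap K L b * i := by
  have hint : IsIntegral K i := ⟨X ^ 2 + 1, by monicity!, by simp [hi]⟩
  rw [← mem_toSubalgebra, adjoin_simple_toSubalgebra_of_isAlgebraic hint.isAlgebraic] at hx
  induction hx using Algebra.adjoin_induction with
  | mem x hx =>
    rw [Set.mem_singleton_iff] at hx
    exact ⟨0, 1, by simp [hx]⟩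
  | algebraMap r => exact ⟨r, 0, by simp⟩
  | add x y _ _ h1 h2 =>
    obtain ⟨a, b, rfl⟩ := h1
    obtain ⟨c, d, rfl⟩ := h2
    exact ⟨a + c, b + d, by simp only [map_add]; ring⟩
  | mul x y _ _ h1 h2 =>
    obtain ⟨a, b, rfl⟩ := h1
    obtain ⟨c, d, rfl⟩ := h2
    refine ⟨a * c - b * d, a * d + b * c, ?_⟩
    simp only [map_add, map_sub, map_mul]
    linear_combination algebraMap K L b * algebraMap K L d * hi

/-! ### Real closed fields: irreducible polynomials have degree at most two. -/

namespace IsRealClosed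

variable (K : Type*) [Field K] [IsRealClosed K]

theorem charZero : CharZero K := by
  obtain ⟨_, _, -⟩ := (isRealClosed_iff_exists_linearOrder K).1 ‹_›
  infer_instance

theorem not_isAlgClosed : ¬ IsAlgClosed K := by
  intro h
  obtain ⟨x, hx⟩ := IsAlgClosed.exists_pow_nat_eq (-1 : K) (n := 2) two_pos
  exact IsSemireal.one_add_ne_zero (IsSumSq.mul_self x) (by linear_combination hx)

variable {K}

/-- Square roots in `K(i)`: the real and imaginary parts of a square root of `a + b * i`. -/
theorem exists_sq_sub_sq_eq (a b : K) : ∃ u v : K, u ^ 2 - v ^ 2 = a ∧ 2 * (u * v) = b := by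
  obtain ⟨_, _, -⟩ := (isRealClosed_iff_exists_linearOrder K).1 ‹_›
  have hsqrt : ∀ x : K, 0 ≤ x → ∃ y, 0 ≤ y ∧ x = y ^ 2 := fun x hx => by
    obtain ⟨y, rfl⟩ := nonneg_iff_isSquare.1 hx
    exact ⟨|y|, abs_nonneg y, by rw [sq_abs, sq]⟩
  -- Here `c` is the modulus of `a + b * i`, so the square root has `u ^ 2 = (c + a) / 2` and `v ^ 2
  -- = (c - a) / 2`; only the sign of `u * v` is left to adjust.
  obtain ⟨c, hc, hcab⟩ := hsqrt (a ^ 2 + b ^ 2) (by positivity)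
  obtain ⟨hl, hr⟩ := abs_le.1 (abs_le_of_sq_le_sq (a := a) (b := c) (by nlinarith [sq_nonneg b]) hc)
  obtain ⟨u, -, hu⟩ := hsqrt ((c + a) / 2) (by linarith)
  obtain ⟨v, -, hv⟩ := hsqrt ((c - a) / 2) (by linarith)
  have huv : (2 * (u * v)) ^ 2 = b ^ 2 := by
    have : (2 * (u * v)) ^ 2 = 4 * (u ^ 2 * v ^ 2) := by ring
    rw [this, ← hu, ← hv]
    linear_combination -hcab
  have ha : u ^ 2 - v ^ 2 = a := by rw [← hu, ← hv]; ring
  rcases sq_eq_sq_iff_eq_or_eq_neg.1 huv with h | h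
  · exact ⟨u, v, ha, h⟩
  · exact ⟨u, -v, by rw [neg_sq, ha], by linear_combination -h⟩

theorem isSquare_of_adjoin {L : Type*} [Field L] [Algebra K L] {i : L} (hi : i ^ 2 = -1)
    (x : K⟮i⟯) : IsSquare x := by
  obtain ⟨a, b, hx⟩ := exists_eq_add_mul_of_mem_adjoin hi x.2
  obtain ⟨u, v, rfl, rfl⟩ := exists_sq_sub_sq_eq a b
  refine ⟨algebraMap K _ u + algebraMap K _ v * AdjoinSimple.gen K i, Subtype.ext ?_⟩
  rw [hx]
  simp only [map_sub, map_pow, map_mul, map_ofNat, MulMemClass.coe_mul, AddMemClass.coe_add,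
    AdjoinSimple.coe_gen, IntermediateField.coe_algebraMap_apply]
  linear_combination -(algebraMap K L v) ^ 2 * hi

theorem natDegree_le_two {f : K[X]} (hf : Irreducible f) : f.natDegree ≤ 2 := by
  have := charZero K
  -- The factor `X ^ 2 + 1` puts a square root of `-1` into the splitting field `E`, which then
  -- turns out to equal `K(i)`.
  let g : K[X] := f * (X ^ 2 + 1)
  let E := g.SplittingField
  have : Normal K E := Normal.of_isSplittingField g
  have : IsGalois K E := { }
  have hm : (X ^ 2 + 1 : K[X]).Monic := by monicity!
  have hd : (X ^ 2 + 1 : K[X]).natDegree = 2 := by compute_degree!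
  have hg : (g.map (algebraMap K E)) ≠ 0 :=
    Polynomial.map_ne_zero (mul_ne_zero hf.ne_zero hm.ne_zero)
  have hs : (g.map (algebraMap K E)).Splits := SplittingField.splits g
  obtain ⟨y, hy⟩ : ∃ y : E, aeval y f = 0 := exists_aeval_eq_zero_of_splits
    (hs.of_dvd hg (Polynomial.map_dvd _ (dvd_mul_right _ _))) hf.natDegree_pos.ne'
  obtain ⟨i, hi⟩ : ∃ i : E, aeval i (X ^ 2 + 1 : K[X]) = 0 := exists_aeval_eq_zero_of_splits
    (hs.of_dvd hg (Polynomial.map_dvd _ (dvd_mul_left _ _))) (by rw [hd]; exact two_ne_zero)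
  have hi2 : i ^ 2 = -1 := by
    simp only [map_add, map_pow, aeval_X, map_one] at hi
    linear_combination hi
  obtain ⟨n, hn⟩ := IsGalois.exists_finrank_eq_two_pow
    (fun (p : K[X]) hp => exists_isRoot_of_odd_natDegree hp) E
  obtain ⟨m, -, hm'⟩ := (Nat.dvd_prime_pow Nat.prime_two).1
    (hn ▸ Dvd.intro_left _ (finrank_mul_finrank K K⟮i⟯ E))
  have h1 := IsGalois.finrank_eq_one_of_forall_isSquare (isSquare_of_adjoin hi2) E hm'
  have h2 := finrank_mul_finrank K K⟮i⟯ E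
  rw [h1, mul_one, adjoin.finrank (Algebra.IsIntegral.isIntegral i)] at h2
  rw [← hf.natDegree_minpoly_eq hy]
  refine (minpoly.natDegree_le y).trans (h2 ▸ ?_)
  rw [← hd]
  exact natDegree_le_of_dvd (minpoly.dvd K i hi) hm.ne_zero

end IsRealClosed

/-! ### Perfectness and the quadratic closure. -/

theorem ringChar_ne_two_iff {K : Type*} [Field K] : ringChar K ≠ 2 ↔ (2 : K) ≠ 0 := by
  refine ⟨Ring.two_ne_zero, fun h h2 => h ?_⟩
  have := (ringChar.spec K 2).2 (by rw [h2])
  exact_mod_cast this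

/-- A field of characteristic not two whose irreducible polynomials have degree at most two is
perfect. -/
theorem PerfectField.of_natDegree_le_two {K : Type*} [Field K] (h2 : (2 : K) ≠ 0)
    (h : ∀ f : K[X], Irreducible f → f.natDegree ≤ 2) : PerfectField K := by
  refine ⟨fun {f} hf => (separable_iff_derivative_ne_zero hf).2 fun hder => ?_⟩
  -- The top coefficient of the derivative is the leading coefficient times the degree, which is `1`
  -- or `2` and so nonzero in `K`.
  have hcoeff := congrArg (fun p => coeff p (f.natDegree - 1)) hder
  have hpos := hf.natDegree_pos
  simp only [coeff_derivative, coeff_zero, Nat.sub_add_cancel hpos, coeff_natDegree] at hcoeff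
  have hle := h f hf
  refine leadingCoeff_ne_zero.2 hf.ne_zero ((mul_eq_zero.1 hcoeff).resolve_right ?_)
  obtain h1 | h1 : f.natDegree = 1 ∨ f.natDegree = 2 := by omega
  · simp [h1]
  · simpa [h1, one_add_one_eq_two] using h2

/-- If `K` is perfect and not algebraically closed and its irreducible polynomials have degree at
most two, then its algebraic closure is a quadratic extension. -/
theorem IsAlgClosure.finrank_eq_two {K L : Type*} [Field K] [Field L] [Algebra K L]
    [IsAlgClosure K L] [PerfectField K] (hK : ¬ IsAlgClosed K)
    (h : ∀ f : K[X], Irreducible f → f.natDegree ≤ 2) : finrank K L = 2 := by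
  have := IsAlgClosure.isAlgebraic (R := K) (K := L)
  have := IsAlgClosure.isAlgClosed (R := K) (K := L)
  obtain ⟨x, hx⟩ : ∃ x : L, x ∉ (⊥ : IntermediateField K L) := by
    by_contra! hall
    refine hK (IsAlgClosed.of_exists_root K fun p _ hp => ?_)
    obtain ⟨y, hy⟩ := IsAlgClosed.exists_aeval_eq_zero L p hp.degree_pos.ne'
    obtain ⟨r, rfl⟩ := mem_bot.1 (hall y)
    rw [aeval_algebraMap_apply, map_eq_zero] at hy
    exact ⟨r, hy⟩
  have hint : ∀ y : L, IsIntegral K y := Algebra.IsIntegral.isIntegral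
  have hx2 : finrank K K⟮x⟯ = 2 := by
    have h1 : finrank K K⟮x⟯ ≠ 1 := fun h1 => hx (finrank_adjoin_simple_eq_one_iff.1 h1)
    rw [adjoin.finrank (hint x)] at h1 ⊢
    have h2 := h _ (minpoly.irreducible (hint x))
    have h3 := minpoly.natDegree_pos (hint x)
    omega
  have htop : K⟮x⟯ = ⊤ := by
    refine eq_top_iff.2 fun y _ => ?_
    have := adjoin.finiteDimensional (hint x)
    have := adjoin.finiteDimensional (hint y)
    -- A primitive element of `K(x, y)` has degree at most two, so `K(x, y)` is no larger than
    -- `K(x)`.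
    obtain ⟨z, hz⟩ := Field.exists_primitive_element K (K⟮x⟯ ⊔ K⟮y⟯ : IntermediateField K L)
    rw [Field.primitive_element_iff_minpoly_natDegree_eq] at hz
    have hle : K⟮x⟯ ≤ K⟮x⟯ ⊔ K⟮y⟯ := le_sup_left
    have heq := eq_of_le_of_finrank_le hle (by
      rw [hx2, ← hz]
      exact h _ (minpoly.irreducible (Algebra.IsIntegral.isIntegral z)))
    rw [heq]
    exact (le_sup_right : K⟮y⟯ ≤ K⟮x⟯ ⊔ K⟮y⟯) (mem_adjoin_simple_self K y)
  rw [← finrank_top', ← htop, hx2]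

/-! ### Conjugations of the algebraic closure. -/

/-- The element `σ` is a conjugation of `L` over `K`: a nontrivial `K`-automorphism of order two
whose only fixed points are the elements of `K`. -/
structure AlgEquiv.IsConjugation {K L : Type*} [Field K] [Field L] [Algebra K L]
    (σ : L ≃ₐ[K] L) : Prop where
  ne_refl : σ ≠ AlgEquiv.refl
  apply_apply : ∀ x, σ (σ x) = x
  mem_range : ∀ x, σ x = x → ∃ a : K, algebraMap K L a = x

/-- The nontrivial element of a Galois group of order two is a conjugation. -/
theorem IsGalois.exists_isConjugation {K L : Type*} [Field K] [Field L] [Algebra K L]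
    [IsGalois K L] (h : Nat.card Gal(L/K) = 2) : ∃ σ : L ≃ₐ[K] L, σ.IsConjugation := by
  have : Finite Gal(L/K) := Nat.finite_of_card_ne_zero (by omega)
  have : Nontrivial Gal(L/K) := Finite.one_lt_card_iff_nontrivial.1 (by omega)
  obtain ⟨σ, hσ⟩ := exists_ne (1 : Gal(L/K))
  refine ⟨σ, hσ, fun x => ?_, fun x hx => mem_bot.1 ?_⟩
  · have h2 : σ ^ 2 = 1 := h ▸ pow_card_eq_one'
    rw [sq] at h2
    exact DFunLike.congr_fun h2 x
  -- Only the group is known to be finite, not the extension; hence the infinite Galois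
  -- correspondence.
  · refine (InfiniteGalois.mem_bot_iff_fixed x).2 fun τ => ?_
    by_cases hτ : τ = 1
    · rw [hτ]
      rfl
    · have hτσ : τ = σ := by
        obtain ⟨ρ, -, hρ⟩ := (Nat.card_eq_two_iff' (1 : Gal(L/K))).1 h
        rw [hρ τ hτ, hρ σ hσ]
      rw [hτσ, hx]

namespace AlgEquiv.IsConjugation

variable {K L : Type*} [Field K] [Field L] [Algebra K L] {σ : L ≃ₐ[K] L}

/-- A root `x` is killed by `(X - x) (X - σ x)`, whose coefficients are fixed by `σ`. -/
theorem natDegree_le_two [IsAlgClosed L] (hσ : σ.IsConjugation) {f : K[X]} (hf : Irreducible f) :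
    f.natDegree ≤ 2 := by
  obtain ⟨x, hx⟩ := IsAlgClosed.exists_aeval_eq_zero L f hf.degree_pos.ne'
  obtain ⟨t, ht⟩ := hσ.mem_range (x + σ x) (by rw [map_add, hσ.apply_apply, add_comm])
  obtain ⟨n, hn⟩ := hσ.mem_range (x * σ x) (by rw [map_mul, hσ.apply_apply, mul_comm])
  have hm : (X ^ 2 - C t * X + C n : K[X]).Monic := by monicity!
  have hd : (X ^ 2 - C t * X + C n : K[X]).natDegree = 2 := by compute_degree!
  rw [← hf.natDegree_minpoly_eq hx, ← hd]
  refine natDegree_le_of_dvd (minpoly.dvd K x ?_) hm.ne_zero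
  simp only [map_add, map_sub, map_mul, map_pow, aeval_X, aeval_C, ht, hn]
  ring

variable [IsAlgClosed L] {i : L}

/-- No square root of `-1` is fixed by a conjugation of an algebraically closed field. -/
theorem apply_sqrt_neg_one (hσ : σ.IsConjugation) (h2 : (2 : K) ≠ 0) (hi : i ^ 2 = -1) :
    σ i = -i := by
  have h1 : σ i ^ 2 = i ^ 2 := by rw [← map_pow, hi, map_neg, map_one]
  refine (sq_eq_sq_iff_eq_or_eq_neg.1 h1).resolve_left fun hfix => ?_
  obtain ⟨z, hz⟩ : ∃ z, σ z ≠ z := by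
    by_contra! hall
    exact hσ.ne_refl (AlgEquiv.ext hall)
  -- As `σ` negates `c ^ 2 = z - σ z`, the element `i * (c * σ c)` squares to `c ^ 4`. If `i` is
  -- fixed, so is this element, hence also `c ^ 2`, which is impossible as `2 ≠ 0`.
  obtain ⟨c, hc⟩ := IsAlgClosed.exists_pow_nat_eq (z - σ z) (n := 2) two_pos
  have hσc : σ c ^ 2 = -c ^ 2 := by rw [← map_pow, hc, map_sub, hσ.apply_apply, neg_sub]
  have hsq : (i * (c * σ c)) ^ 2 = (c ^ 2) ^ 2 := by
    rw [mul_pow, mul_pow, hi, hσc]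
    ring
  have hfix2 : σ (i * (c * σ c)) = i * (c * σ c) := by
    rw [map_mul, map_mul, hfix, hσ.apply_apply, mul_comm c]
  have hfix3 : σ (c ^ 2) = c ^ 2 := by
    rcases sq_eq_sq_iff_eq_or_eq_neg.1 hsq with h | h
    · rw [← h, hfix2]
    · rw [← neg_eq_iff_eq_neg.2 h, map_neg, hfix2]
  rw [hc, map_sub, hσ.apply_apply] at hfix3
  have h2L : (2 : L) ≠ 0 := by
    rw [← map_ofNat (algebraMap K L)]
    exact (_root_.map_ne_zero _).2 h2
  have h0 : 2 * (σ z - z) = 0 := by linear_combination hfix3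
  exact hz (sub_eq_zero.1 ((mul_eq_zero.1 h0).resolve_left h2L))

theorem not_isSquare_neg_one (hσ : σ.IsConjugation) (h2 : (2 : K) ≠ 0) :
    ¬ IsSquare (-1 : K) := by
  rintro ⟨r, hr⟩
  have h1 := hσ.apply_sqrt_neg_one h2 (i := algebraMap K L r) (by
    rw [sq, ← map_mul, ← hr, map_neg, map_one])
  rw [σ.commutes, ← map_neg] at h1
  have h3 := (algebraMap K L).injective h1
  have h4 : 2 * r = 0 := by linear_combination h3
  rw [(mul_eq_zero.1 h4).resolve_left h2] at hr
  simp at hr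

/-- With `a + b * i = c ^ 2`, the norm `a ^ 2 + b ^ 2 = (a + b * i) * (a - b * i)` is the square of
`c * σ c`, which is fixed by `σ`. -/
theorem isSquare_add (hσ : σ.IsConjugation) (h2 : (2 : K) ≠ 0) {x y : K} (hx : IsSquare x)
    (hy : IsSquare y) : IsSquare (x + y) := by
  obtain ⟨a, rfl⟩ := hx
  obtain ⟨b, rfl⟩ := hy
  obtain ⟨i, hi⟩ := IsAlgClosed.exists_pow_nat_eq (-1 : L) (n := 2) two_pos
  obtain ⟨c, hc⟩ := IsAlgClosed.exists_pow_nat_eq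
    (algebraMap K L a + algebraMap K L b * i) (n := 2) two_pos
  obtain ⟨n, hn⟩ := hσ.mem_range (c * σ c) (by rw [map_mul, hσ.apply_apply, mul_comm])
  have hσc := congrArg σ hc
  rw [map_pow, map_add, map_mul, σ.commutes, σ.commutes, hσ.apply_sqrt_neg_one h2 hi] at hσc
  refine ⟨n, (algebraMap K L).injective ?_⟩
  rw [map_mul, hn, map_add, map_mul, map_mul]
  calc _ = (algebraMap K L a + algebraMap K L b * i) *
        (algebraMap K L a + algebraMap K L b * -i) := by
          linear_combination algebraMap K L b ^ 2 * hi
    _ = _ := by rw [← hc, ← hσc]; ring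

/-- A square root `x` of `a` is either fixed or negated by `σ`; when negated, `x * i` is fixed and
squares to `-a`. -/
theorem isSquare_or_isSquare_neg (hσ : σ.IsConjugation) (h2 : (2 : K) ≠ 0) (a : K) :
    IsSquare a ∨ IsSquare (-a) := by
  obtain ⟨i, hi⟩ := IsAlgClosed.exists_pow_nat_eq (-1 : L) (n := 2) two_pos
  obtain ⟨x, hx⟩ := IsAlgClosed.exists_pow_nat_eq (algebraMap K L a) (n := 2) two_pos
  have h1 : σ x ^ 2 = x ^ 2 := by rw [← map_pow, hx, σ.commutes]
  rcases sq_eq_sq_iff_eq_or_eq_neg.1 h1 with h | h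
  · obtain ⟨r, rfl⟩ := hσ.mem_range x h
    exact Or.inl ⟨r, (algebraMap K L).injective (by rw [← hx, map_mul, sq])⟩
  · obtain ⟨r, hr⟩ := hσ.mem_range (x * i) (by
      rw [map_mul, h, hσ.apply_sqrt_neg_one h2 hi, neg_mul_neg])
    refine Or.inr ⟨r, (algebraMap K L).injective ?_⟩
    rw [map_mul, hr, map_neg, ← hx]
    linear_combination -x ^ 2 * hi

theorem isRealClosed (hσ : σ.IsConjugation) (h2 : (2 : K) ≠ 0) : IsRealClosed K where
  one_add_ne_zero {s} hs h0 := by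
    have hsq : IsSquare s := by
      clear h0
      induction hs with
      | zero => exact IsSquare.zero
      | sq_add a _ ih => exact hσ.isSquare_add h2 ⟨a, rfl⟩ ih
    rw [eq_neg_of_add_eq_zero_right h0] at hsq
    exact hσ.not_isSquare_neg_one h2 hsq
  isSquare_or_isSquare_neg := hσ.isSquare_or_isSquare_neg h2
  exists_isRoot_of_odd_natDegree {f} := by
    induction f using WfDvdMonoid.induction_on_irreducible with
    | zero => simp
    | unit u hu =>
      intro hodd
      rw [natDegree_eq_zero_of_isUnit hu] at hodd
      simp at hodd
    | mul f g hf hg ih =>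
      intro hodd
      rw [natDegree_mul hg.ne_zero hf] at hodd
      have hg2 := hσ.natDegree_le_two hg
      have hg0 := hg.natDegree_pos
      obtain h1 | h1 : g.natDegree = 1 ∨ g.natDegree = 2 := by omega
      · obtain ⟨x, hx⟩ := exists_root_of_degree_eq_one
          ((degree_eq_iff_natDegree_eq_of_pos one_pos).2 h1)
        exact ⟨x, root_mul_right_of_isRoot _ hx⟩
      -- Removing a quadratic factor preserves the parity of the degree.
      · obtain ⟨x, hx⟩ := ih (by rw [h1] at hodd; rw [Nat.odd_iff] at *; omega)
        exact ⟨x, root_mul_left_of_isRoot _ hx⟩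

end AlgEquiv.IsConjugation

/-! ### The projection and the involution in terms of a conjugation. -/

namespace FieldProjection

variable {K : Type*} [Field K] {L : Type*} [Field L] [Algebra K L]

theorem regularSet_eq_univ [CharZero K] [Algebra.IsIntegral K L] : regularSet K L = Set.univ := by
  refine Set.eq_univ_of_forall fun x hx => ?_
  rw [(CharP.ringChar_zero_iff_CharZero K).2 ‹_›, zero_dvd_iff] at hx
  exact (minpoly.natDegree_pos (Algebra.IsIntegral.isIntegral x)).ne' hx

theorem proj_algebraMap {x : regularSet K L} {a : K} (hx : (x : L) = algebraMap K L a) :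
    proj K x = a := by
  rw [proj, hx, minpoly.eq_X_sub_C]
  simp

/-- A conjugation adds up with the identity to twice the projection. -/
theorem two_mul_proj {σ : L ≃ₐ[K] L} (hσ : σ.IsConjugation) (h2 : (2 : K) ≠ 0)
    (x : regularSet K L) : 2 * algebraMap K L (proj K x) = x + σ x := by
  have hint := regularSet_isIntegral K x.2
  -- Off `K` the polynomial `(X - x) (X - σ x)` is minimal; on `K` the minimal polynomial is linear.
  by_cases hx : ∃ a : K, algebraMap K L a = x
  · obtain ⟨a, ha⟩ := hx
    rw [proj_algebraMap ha.symm, ← ha, σ.commutes, two_mul]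
  obtain ⟨t, ht⟩ := hσ.mem_range (x + σ x) (by rw [map_add, hσ.apply_apply, add_comm])
  obtain ⟨n, hn⟩ := hσ.mem_range (x * σ x) (by rw [map_mul, hσ.apply_apply, mul_comm])
  have hm : (X ^ 2 - C t * X + C n : K[X]).Monic := by monicity!
  have hd : (X ^ 2 - C t * X + C n : K[X]).natDegree = 2 := by compute_degree!
  have hmin : X ^ 2 - C t * X + C n = minpoly K (x : L) := by
    refine eq_of_monic_of_dvd_of_natDegree_le (minpoly.monic hint) hm (minpoly.dvd K _ ?_) ?_
    · simp only [map_add, map_sub, map_mul, map_pow, aeval_X, aeval_C, ht, hn]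
      ring
    · rw [hd]
      by_contra! hlt
      refine hx (minpoly.mem_range_of_degree_eq_one K (x : L)
        ((degree_eq_iff_natDegree_eq_of_pos one_pos).2 ?_))
      have := minpoly.natDegree_pos hint
      omega
  have hproj : 2 * proj K x = t := by
    rw [proj, ← hmin, hd]
    simp [coeff_C]
    field_simp
  rw [← ht, ← hproj, map_mul, map_ofNat]

theorem coe_involution (x : regularSet K L) :
    (involution K x : L) = 2 * algebraMap K L (proj K x) - x := by
  simp only [involution, vert]
  ring

/-- If the involution is a nontrivial automorphism then it is a conjugation. -/
theorem isConjugation_of_eq_involution (hR : regularSet K L = Set.univ) {σ : L ≃ₐ[K] L}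
    (hne : σ ≠ AlgEquiv.refl)
    (hσ : ∀ x : regularSet K L, σ x = (involution K x : L)) :
    σ.IsConjugation ∧ (2 : K) ≠ 0 := by
  have hσ' : ∀ x : L, ∃ a : K, σ x = 2 * algebraMap K L a - x := fun x =>
    ⟨_, (hσ ⟨x, hR ▸ Set.mem_univ x⟩).trans (coe_involution _)⟩
  -- In characteristic two, `2 a - x = x`, so the involution would be the identity.
  have h2 : (2 : K) ≠ 0 := by
    intro h2
    have h2L : (2 : L) = 0 := by rw [← map_ofNat (algebraMap K L), h2, map_zero]
    refine hne (AlgEquiv.ext fun x => ?_)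
    obtain ⟨a, ha⟩ := hσ' x
    rw [ha, AlgEquiv.coe_refl, id]
    linear_combination (algebraMap K L a - x) * h2L
  have h2L : (2 : L) ≠ 0 := by
    rw [← map_ofNat (algebraMap K L)]
    exact (_root_.map_ne_zero _).2 h2
  refine ⟨⟨hne, fun x => ?_, fun x hx => ?_⟩, h2⟩
  · obtain ⟨a, ha⟩ := hσ' x
    rw [ha, map_sub, map_mul, map_ofNat, σ.commutes, ha]
    ring
  · obtain ⟨a, ha⟩ := hσ' x
    rw [hx] at ha
    exact ⟨a, mul_left_cancel₀ h2L (by linear_combination -ha)⟩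

/-- By `two_mul_proj` the kernel is the `-1`-eigenspace of `σ`, and multiplication by `i` carries it
into the fixed field `K`. -/
theorem projKer_eq_span [IsAlgClosed L] {σ : L ≃ₐ[K] L} (hσ : σ.IsConjugation)
    (h2 : (2 : K) ≠ 0) (hR : regularSet K L = Set.univ) {i : L} (hi : i ^ 2 = -1) :
    projKer K L = (Submodule.span K {i} : Set L) := by
  have hσi := hσ.apply_sqrt_neg_one h2 hi
  have h2L : (2 : L) ≠ 0 := by
    rw [← map_ofNat (algebraMap K L)]
    exact (_root_.map_ne_zero _).2 h2
  ext x
  rw [SetLike.mem_coe, Submodule.mem_span_singleton]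
  constructor
  · rintro ⟨hx, hx0⟩
    have h := two_mul_proj hσ h2 ⟨x, hx⟩
    rw [hx0, map_zero, mul_zero] at h
    obtain ⟨r, hr⟩ := hσ.mem_range (x * i) (by
      rw [map_mul, hσi]
      linear_combination i * h)
    refine ⟨-r, ?_⟩
    rw [Algebra.smul_def, map_neg, hr]
    linear_combination -x * hi
  · rintro ⟨r, rfl⟩
    have hx : r • i ∈ regularSet K L := hR ▸ Set.mem_univ _
    refine ⟨hx, (algebraMap K L).injective ?_⟩
    have h := two_mul_proj hσ h2 ⟨r • i, hx⟩
    rw [map_smul, hσi, smul_neg, add_neg_cancel] at h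
    rw [map_zero]
    exact (mul_eq_zero.1 h).resolve_left h2L

/-- A square root of `-1` that spans the kernel of the projection is not in the base field. -/
theorem forall_algebraMap_ne {i : L} (hi : i ^ 2 = -1)
    (hker : projKer K L = (Submodule.span K {i} : Set L)) (a : K) : algebraMap K L a ≠ i := by
  rintro rfl
  obtain ⟨hmem, hproj⟩ : algebraMap K L a ∈ projKer K L :=
    hker ▸ Submodule.mem_span_singleton_self _
  rw [proj_algebraMap rfl] at hproj
  rw [hproj, map_zero] at hi
  simp at hi

/-- Every element decomposes as `a + b * i`, a root of `X ^ 2 - 2 a X + (a ^ 2 + b ^ 2)`. -/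
theorem natDegree_le_two_of_projKer_eq_span [IsAlgClosed L] {i : L} (hi : i ^ 2 = -1)
    (hR : regularSet K L = Set.univ) (hker : projKer K L = (Submodule.span K {i} : Set L))
    {f : K[X]} (hf : Irreducible f) : f.natDegree ≤ 2 := by
  obtain ⟨x, hx⟩ := IsAlgClosed.exists_aeval_eq_zero L f hf.degree_pos.ne'
  obtain ⟨hsum, hv⟩ := (decomposition_iff K ⟨x, hR ▸ Set.mem_univ x⟩ _ _).2 ⟨rfl, rfl⟩
  rw [hker, SetLike.mem_coe, Submodule.mem_span_singleton] at hv
  obtain ⟨b, hb⟩ := hv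
  rw [← hb, Algebra.smul_def] at hsum
  generalize proj K (L := L) _ = a at hsum
  have hm : (X ^ 2 - C (2 * a) * X + C (a ^ 2 + b ^ 2) : K[X]).Monic := by monicity!
  have hd : (X ^ 2 - C (2 * a) * X + C (a ^ 2 + b ^ 2) : K[X]).natDegree = 2 := by
    compute_degree!
  rw [← hf.natDegree_minpoly_eq hx, ← hd]
  refine natDegree_le_of_dvd (minpoly.dvd K x ?_) hm.ne_zero
  change x = _ at hsum
  simp only [map_add, map_sub, map_mul, map_pow, map_ofNat, aeval_X, aeval_C]
  rw [hsum]
  linear_combination algebraMap K L b ^ 2 * hi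

end FieldProjection

/-! ### Splitting bounds of matrices. -/

/-- Every nonzero polynomial is, up to a constant, the minimal polynomial of a matrix. -/
theorem Matrix.exists_minpoly_eq {K : Type*} [Field K] {f : K[X]} (hf : f ≠ 0) :
    ∃ (n : ℕ) (M : Matrix (Fin n) (Fin n) K), minpoly K M = f * C f.leadingCoeff⁻¹ := by
  let B := AdjoinRoot.powerBasis hf
  -- The matrix is that of multiplication by the class of `X` on `K[X] / (f)`.
  refine ⟨B.dim, Algebra.leftMulMatrix B.basis (AdjoinRoot.root f), ?_⟩
  rw [minpoly.algHom_eq _ (Algebra.leftMulMatrix_injective B.basis), AdjoinRoot.minpoly_root hf]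

theorem Matrix.forall_splittingBound_le_iff {K : Type*} [Field K] (d : ℕ) :
    (∀ (n : ℕ) (M : Matrix (Fin n) (Fin n) K), M.splittingBound K ≤ d) ↔
      ∀ f : K[X], Irreducible f → f.natDegree ≤ d := by
  constructor
  · intro h f hf
    obtain ⟨n, M, hM⟩ := exists_minpoly_eq hf.ne_zero
    have hle := h n M
    rw [Matrix.splittingBound, Polynomial.splittingBound, iSup_le_iff] at hle
    have hf' := iSup_le_iff.1 (iSup_le_iff.1 (hle f) hf) (by
      rw [hM, Algebra.algebraMap_self, Polynomial.map_id]
      exact dvd_mul_right _ _)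
    exact_mod_cast hf'
  · intro h n M
    exact iSup_le fun g => iSup_le fun hg => iSup_le fun _ => by exact_mod_cast h g hg

/-! ### The equivalences. -/

theorem mainTheorem5 (K : Type*) [Field K] (Kbar : Type*) [Field Kbar] [Algebra K Kbar]
    [IsAlgClosure K Kbar] (i : Kbar) (hi : i ^ 2 = -1) :
    List.TFAE [
      IsRealClosed K,
      ¬ IsAlgClosed K ∧ ringChar K ≠ 2 ∧ ∀ f : K[X], Irreducible f → f.natDegree ≤ 2,
      PerfectField K ∧ ringChar K ≠ 2 ∧ Nat.card (Kbar ≃ₐ[K] Kbar) = 2,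
      FieldProjection.regularSet K Kbar = Set.univ ∧
        ∃ σ : Kbar ≃ₐ[K] Kbar, σ ≠ AlgEquiv.refl ∧
          ∀ x : FieldProjection.regularSet K Kbar,
            σ (x : Kbar) = (FieldProjection.involution K x : Kbar),
      FieldProjection.regularSet K Kbar = Set.univ ∧
        FieldProjection.projKer K Kbar = (Submodule.span K {i} : Set Kbar),
      ¬ IsAlgClosed K ∧ ringChar K ≠ 2 ∧
        ∀ (n : ℕ) (M : Matrix (Fin n) (Fin n) K), M.splittingBound K ≤ 2] := by
  have := IsAlgClosure.isAlgebraic (R := K) (K := Kbar)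
  have := IsAlgClosure.isAlgClosed (R := K) (K := Kbar)
  have := IsAlgClosure.normal K Kbar
  simp only [ringChar_ne_two_iff]
  tfae_have 1 → 2 := fun h => by
    have := IsRealClosed.charZero K
    exact ⟨IsRealClosed.not_isAlgClosed K, two_ne_zero, fun f => IsRealClosed.natDegree_le_two⟩
  tfae_have 2 → 3 := fun ⟨hK, h2, h⟩ => by
    have hperf := PerfectField.of_natDegree_le_two h2 h
    have hrank : finrank K Kbar = 2 := IsAlgClosure.finrank_eq_two hK h
    have : FiniteDimensional K Kbar := finite_of_finrank_eq_succ hrank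
    have : IsGalois K Kbar := { }
    exact ⟨hperf, h2, by rw [IsGalois.card_aut_eq_finrank, hrank]⟩
  tfae_have 3 → 4 := fun ⟨_, h2, hcard⟩ => by
    have : IsGalois K Kbar := { }
    obtain ⟨σ, hσ⟩ := IsGalois.exists_isConjugation hcard
    -- Regularity of all elements comes from characteristic zero, which is obtained by way of real
    -- closedness.
    have := hσ.isRealClosed h2
    have := IsRealClosed.charZero K
    refine ⟨FieldProjection.regularSet_eq_univ, σ, hσ.ne_refl, fun x => ?_⟩
    rw [FieldProjection.coe_involution, FieldProjection.two_mul_proj hσ h2]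
    ring
  tfae_have 4 → 1 := fun ⟨hR, σ, hne, hσ⟩ =>
    have ⟨hconj, h2⟩ := FieldProjection.isConjugation_of_eq_involution hR hne hσ
    hconj.isRealClosed h2
  tfae_have 4 → 5 := fun ⟨hR, σ, hne, hσ⟩ =>
    have ⟨hconj, h2⟩ := FieldProjection.isConjugation_of_eq_involution hR hne hσ
    ⟨hR, FieldProjection.projKer_eq_span hconj h2 hR hi⟩
  tfae_have 5 → 2 := fun ⟨hR, hker⟩ => by
    have hne := FieldProjection.forall_algebraMap_ne hi hker
    refine ⟨fun _ => ?_, fun h2 => ?_,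
      fun f => FieldProjection.natDegree_le_two_of_projKer_eq_span hi hR hker⟩
    · obtain ⟨a, ha⟩ := (IsAlgClosed.algebraMap_bijective_of_isIntegral (k := K) (K := Kbar)).2 i
      exact hne a ha
    · have h2' : (2 : Kbar) = 0 := by rw [← map_ofNat (algebraMap K Kbar), h2, map_zero]
      -- In characteristic two the only square root of `-1` is `1`, which lies in `K`.
      have h0 : (1 - i) ^ 2 = 0 := by linear_combination hi - i * h2'
      refine hne 1 ?_
      rw [map_one]
      exact sub_eq_zero.1 (pow_eq_zero_iff two_ne_zero |>.1 h0)
  tfae_have 2 ↔ 6 := by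
    rw [← Matrix.forall_splittingBound_le_iff 2]
    rfl
  tfae_finish
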